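/- Let $k\ge 3$ be an integer and let $G$ be a finite simple graph that is bipartite and outerplanar (that is, $G$ has a planar drawing in which all vertices belong to the outer face), with maximum degree $\Delta(G)\le k$. Then $G$ is $(1,3,\ldots,3)$-packing colorable, where the integer $3$ appears $k$ times; that is, there is a map $c:V(G)\to\{0,1,\ldots,k\}$ such that any two distinct vertices $x,y$ with $c(x)=c(y)=0$ satisfy $d_G(x,y)>1$, and any two distinct vertices $x,y$ with $c(x)=c(y)\ne 0$ satisfy $d_G(x,y)>3$ (where $d_G(x,y)=\infty$ if $x$ and $y$ lie in different components). $G$ is required to be neither connected nor $2$-connected. -/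

import Mathlib

namespace SimpleGraph

/-- A drawing of the graph `G` in the Euclidean plane without crossings. Vertices are distinct
points, every edge is a simple arc joining its two endpoints (one arc per edge, traversed in the
two directions by the two darts of the edge), an arc contains no vertex except its endpoints, and
arcs of distinct edges meet only at common endpoints. -/
structure PlaneDrawing {V : Type*} (G : SimpleGraph V) where
  /-- the point that represents a vertex -/
  pos : V → EuclideanSpace ℝ (Fin 2)
  /-- the arc that represents an edge, parametrized from the first to the second vertex -/
  arc : (d : G.Dart) → _root_.Path (pos d.fst) (pos d.snd)
  pos_injective : Function.Injective pos
  arc_injective : ∀ d : G.Dart, Function.Injective (arc d)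
  arc_symm : ∀ d : G.Dart, arc d.symm = (arc d).symm
  eq_endpoint_of_pos_mem_arc : ∀ (d : G.Dart) (v : V),
    pos v ∈ Set.range (arc d) → v = d.fst ∨ v = d.snd
  arc_inter_arc : ∀ d e : G.Dart, d.edge ≠ e.edge →
    ∀ p ∈ Set.range (arc d) ∩ Set.range (arc e), ∃ v : V, v ∈ d.edge ∧ v ∈ e.edge ∧ pos v = p

/-- The set of all points of the plane that are used by the drawing. -/
def PlaneDrawing.support {V : Type*} {G : SimpleGraph V} (D : G.PlaneDrawing) :
    Set (EuclideanSpace ℝ (Fin 2)) :=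
  Set.range D.pos ∪ ⋃ d : G.Dart, Set.range (D.arc d)

/-- The outer face: the unbounded connected component of the complement of the drawing. (The
drawing of a finite graph is compact, so there is exactly one unbounded component.) -/
def PlaneDrawing.outerFace {V : Type*} {G : SimpleGraph V} (D : G.PlaneDrawing) :
    Set (EuclideanSpace ℝ (Fin 2)) :=
  {p | p ∈ D.supportᶜ ∧ ¬ Bornology.IsBounded (connectedComponentIn D.supportᶜ p)}

/-- A graph is outerplanar if it has a planar drawing in which all vertices belong to
(the boundary of) the outer face. -/
def IsOuterplanar {V : Type*} (G : SimpleGraph V) : Prop :=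
  ∃ D : G.PlaneDrawing, ∀ v : V, D.pos v ∈ frontier D.outerFace

/-- `A` is a `d`-packing in `G`: any two distinct vertices of `A` are at distance greater than `d`
(the distance of vertices in different components is `⊤`). -/
def IsDistPacking {V : Type*} (G : SimpleGraph V) (d : ℕ) (A : Set V) : Prop :=
  ∀ x ∈ A, ∀ y ∈ A, x ≠ y → (d : ℕ∞) < G.edist x y

/-- `c` is an `S`-packing coloring of `G` for the sequence `S` of integers. -/
def IsPackingColoring {V : Type*} (G : SimpleGraph V) {m : ℕ} (S : Fin m → ℕ)
    (c : V → Fin m) : Prop :=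
  ∀ i : Fin m, G.IsDistPacking (S i) (c ⁻¹' {i})

/-- `G` is `S`-packing colorable. -/
def IsPackingColorable {V : Type*} (G : SimpleGraph V) {m : ℕ} (S : Fin m → ℕ) : Prop :=
  ∃ c : V → Fin m, G.IsPackingColoring S c

end SimpleGraph

/-! Give color 0 to one side `A` of the bipartition. Two vertices of the other side are never at
distance 1 or 3, so the remaining `k` colors only have to separate vertices with a common neighbour
in `A` (`IsRainbowOn`).

Such a coloring is built by strong induction on the vertex set `S` of an induced subgraph. If every
vertex has at most two neighbours in `S`, a vertex outside `A` conflicts with at most two others,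
and three colors suffice to add it. Otherwise some `v` has three neighbours in `S`, and by
`IsOuterplanar.not_reachable` one of them, say `q`, separates the other two once `v` is deleted. The
edge `vq` then splits `S` into two smaller pieces. Their colorings are glued along the at most `k`
neighbours of the end of `vq` in `A`, after a permutation of the colors of one piece.

The separation property comes from the nonplanarity of `K₅`: a point far out in the outer face, `v`
and its three neighbours would give a drawing of `K₅` without crossings of independent edges. Arcs
with a common end may still meet, so the strong form `exists_path_meet_of_fin_five` is needed; it is
proved by a count modulo 4 of logarithm increments. -/

/-! ### Logarithm increments and drawings of `K₅` -/

/-- The increment over `[0, 1]` of a continuous branch of the logarithm along `f`. -/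
noncomputable def logIncrement (f : ℝ → ℂ) : ℂ :=
  open Classical in
  if h : ∃ g : ℝ → ℂ, Continuous g ∧ ∀ x, Complex.exp (g x) = f x then h.choose 1 - h.choose 0
  else 0

theorem Complex.exists_continuous_exp_eq {A : Type*} [TopologicalSpace A] [SimplyConnectedSpace A]
    [LocallyPathConnectedSpace A] {f : A → ℂ} (hf : Continuous f) (h0 : ∀ x, f x ≠ 0) :
    ∃ g : A → ℂ, Continuous g ∧ ∀ x, Complex.exp (g x) = f x := by
  obtain ⟨a⟩ : Nonempty A := inferInstance
  obtain ⟨g, ⟨-, hg⟩, -⟩ := Complex.isCoveringMapOn_exp.existsUnique_continuousMap_lifts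
    ⟨f, hf⟩ (a₀ := a) (Complex.exp_log (h0 a)) (fun x => h0 x)
  exact ⟨g, g.continuous, fun x => congrFun hg x⟩

theorem logIncrement_eq {f g : ℝ → ℂ} (hg : Continuous g) (h : ∀ x, Complex.exp (g x) = f x) :
    logIncrement f = g 1 - g 0 := by
  have hex : ∃ g : ℝ → ℂ, Continuous g ∧ ∀ x, Complex.exp (g x) = f x := ⟨g, hg, h⟩
  rw [logIncrement, dif_pos hex]
  obtain ⟨hc, he⟩ := hex.choose_spec
  set g' := hex.choose
  have hf : Continuous f := by
    rw [← funext h]; fun_prop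
  have hd : Complex.exp (g' 0 - g 0) = 1 := by
    rw [Complex.exp_sub, he, h, div_self]
    rw [← h]; exact Complex.exp_ne_zero _
  have huniq := (Complex.isCoveringMapOn_exp.existsUnique_continuousMap_lifts
    ⟨f, hf⟩ (a₀ := (0 : ℝ)) (e₀ := g' 0) (he 0)
    (fun x => by simp [← h])).unique (y₁ := ⟨g', hc⟩)
    (y₂ := ⟨fun x => g x + (g' 0 - g 0), by fun_prop⟩)
    ⟨rfl, funext he⟩ ⟨by simp, funext fun x => by simp [Complex.exp_add, hd, h]⟩
  have h1 : g' 1 = g 1 + (g' 0 - g 0) := congrArg (fun F : C(ℝ, ℂ) => F 1) huniq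
  rw [h1]; ring

/-- A single branch of log(γ(s) − δ(t)) exists on the whole (s, t)-plane, and both sides are the
same alternating sum of its values at the four corners of the unit square. -/
theorem logIncrement_sub_comm {γ δ : ℝ → ℂ} (hγ : Continuous γ) (hδ : Continuous δ)
    (h : ∀ s t, γ s ≠ δ t) :
    logIncrement (fun s => γ s - δ 1) - logIncrement (fun s => γ s - δ 0) =
      logIncrement (fun t => δ t - γ 1) - logIncrement (fun t => δ t - γ 0) := by
  obtain ⟨g, hg, he⟩ := Complex.exists_continuous_exp_eq (f := fun x : ℝ × ℝ => γ x.1 - δ x.2)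
    (by fun_prop) (fun x => sub_ne_zero.2 (h _ _))
  have h1 : ∀ t, logIncrement (fun s => γ s - δ t) = g (1, t) - g (0, t) := fun t =>
    logIncrement_eq (g := fun s => g (s, t)) (by fun_prop) (fun s => he (s, t))
  have h2 : ∀ s, logIncrement (fun t => δ t - γ s) = g (s, 1) - g (s, 0) := fun s => by
    -- The shift by πi accounts for δ(t) − γ(s) = −(γ(s) − δ(t)).
    rw [logIncrement_eq (g := fun t => g (s, t) + Real.pi * Complex.I) (by fun_prop)
      (fun t => by rw [Complex.exp_add, he, Complex.exp_pi_mul_I]; ring)]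
    ring
  rw [h1, h1, h2, h2]; ring

theorem exists_logIncrement_eq {f : ℝ → ℂ} (hf : Continuous f) (h0 : ∀ x, f x ≠ 0) :
    ∃ n : ℤ, logIncrement f =
      Complex.log (f 1) - Complex.log (f 0) + n * (2 * Real.pi * Complex.I) := by
  obtain ⟨g, hg, he⟩ := Complex.exists_continuous_exp_eq hf h0
  rw [logIncrement_eq hg he, ← Complex.exp_eq_exp_iff_exists_int]
  rw [Complex.exp_sub, Complex.exp_sub, he, he, Complex.exp_log (h0 _), Complex.exp_log (h0 _)]

theorem Complex.exists_log_sub_log_neg {z : ℂ} (hz : z ≠ 0) :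
    ∃ m : ℤ, Complex.log z - Complex.log (-z) = ((2 * m + 1 : ℤ) : ℂ) * (Real.pi * Complex.I) := by
  have : Complex.exp (Complex.log z) = Complex.exp (Complex.log (-z) + Real.pi * Complex.I) := by
    rw [Complex.exp_add, Complex.exp_log hz, Complex.exp_log (neg_ne_zero.2 hz),
      Complex.exp_pi_mul_I]
    ring
  obtain ⟨m, hm⟩ := Complex.exp_eq_exp_iff_exists_int.1 this
  refine ⟨m, ?_⟩
  rw [hm]; push_cast; ring

/-- In every drawing of the complete graph on five vertices in the plane, two independent edges
meet. -/
theorem exists_path_meet_of_fin_five (P : Fin 5 → ℂ) (γ : ∀ i j, Path (P i) (P j)) :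
    ∃ i j k l : Fin 5, i < j ∧ k < l ∧ i < k ∧ j ≠ k ∧ j ≠ l ∧
      ∃ s t, γ i j s = γ k l t := by
  by_contra! H
  have Hx : ∀ i j k l : Fin 5, i < j → k < l → i ≠ k → i ≠ l → j ≠ k → j ≠ l →
      ∀ s t, (γ i j).extend s ≠ (γ k l).extend t := by
    intro i j k l hij hkl hik hil hjk hjl s t
    rcases lt_or_gt_of_ne hik with h | h
    · exact H i j k l hij hkl h hjk hjl _ _
    · exact (H k l i j hkl hij h hil.symm hjl.symm _ _).symm
  -- Distinct vertices are ends of two independent edges, which do not meet.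
  have hinj : ∀ x y, x ≠ y → P x ≠ P y := by
    have key : ∀ x y : Fin 5, x ≠ y → ∃ u v : Fin 5, u ≠ v ∧ x ≠ u ∧ x ≠ v ∧ y ≠ u ∧ y ≠ v := by
      decide
    intro x y hxy
    obtain ⟨u, v, huv, hxu, hxv, hyu, hyv⟩ := key x y hxy
    have endpt : ∀ a b : Fin 5, a ≠ b → ∃ i j, i < j ∧ (i = a ∧ j = b ∨ i = b ∧ j = a) ∧
        ∃ s, (γ i j).extend s = P a := by
      intro a b hab
      rcases lt_or_gt_of_ne hab with h | h
      · exact ⟨a, b, h, by simp, 0, by simp⟩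
      · exact ⟨b, a, h, by simp, 1, by simp⟩
    obtain ⟨i, j, hij, hx, s, hs⟩ := endpt x u hxu
    obtain ⟨k, l, hkl, hy, t, ht⟩ := endpt y v hyv
    rw [← hs, ← ht]
    apply Hx i j k l hij hkl <;> grind
  have hS : ∀ x y, ∃ m : ℤ, x ≠ y → Complex.log (P x - P y) - Complex.log (P y - P x) =
      ((2 * m + 1 : ℤ) : ℂ) * (Real.pi * Complex.I) := by
    intro x y
    by_cases hxy : x = y
    · exact ⟨0, fun h => absurd hxy h⟩
    · obtain ⟨m, hm⟩ := Complex.exists_log_sub_log_neg (sub_ne_zero.2 (hinj x y hxy))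
      exact ⟨m, fun _ => by rw [← hm, neg_sub]⟩
  choose m hm using hS
  have hN : ∀ i j z : Fin 5, ∃ n : ℤ, i < j → z ≠ i → z ≠ j →
      logIncrement (fun s => (γ i j).extend s - P z) =
        Complex.log (P j - P z) - Complex.log (P i - P z) + n * (2 * Real.pi * Complex.I) := by
    intro i j z
    by_cases h : i < j ∧ z ≠ i ∧ z ≠ j
    · obtain ⟨hij, hi, hj⟩ := h
      have key : ∀ i j z : Fin 5, i < j → z ≠ i → z ≠ j →
          ∃ w, w ≠ i ∧ w ≠ j ∧ z ≠ w := by decide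
      -- The arc `ij` avoids `P z` because `P z` lies on the independent arc joining `z` and `w`.
      obtain ⟨w, hwi, hwj, hzw⟩ := key i j z hij hi hj
      obtain ⟨n, hn⟩ := exists_logIncrement_eq (f := fun s => (γ i j).extend s - P z)
        (by fun_prop) (fun s => by
          rw [sub_ne_zero]
          rcases lt_or_gt_of_ne hzw with hlt | hlt
          · simpa using Hx i j z w hij hlt hi.symm hwi.symm hj.symm hwj.symm s 0
          · simpa using Hx i j w z hij hlt hwi.symm hi.symm hwj.symm hj.symm s 1)
      exact ⟨n, fun _ _ _ => by simpa using hn⟩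
    · exact ⟨0, fun h1 h2 h3 => absurd ⟨h1, h2, h3⟩ h⟩
  choose n hn using hN
  have hπ : (Real.pi * Complex.I : ℂ) ≠ 0 := by simp [Real.pi_ne_zero]
  have hanti : ∀ x y, x ≠ y → 2 * m x y + 1 = -(2 * m y x + 1) := by
    intro x y hxy
    have h1 := hm x y hxy
    have h2 := hm y x hxy.symm
    have : ((2 * m x y + 1 : ℤ) : ℂ) = ((-(2 * m y x + 1) : ℤ) : ℂ) := by
      apply mul_right_cancel₀ hπ
      rw [← h1, Int.cast_neg, neg_mul, ← h2]; ring
    exact_mod_cast this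
  have hrel : ∀ a b c d : Fin 5, a < b → c < d → a ≠ c → a ≠ d → b ≠ c → b ≠ d →
      (2 * m b d + 1) - (2 * m a d + 1) - (2 * m b c + 1) + (2 * m a c + 1) +
        2 * (n a b d - n a b c - n c d b + n c d a) = 0 := by
    intro a b c d hab hcd hac had hbc hbd
    have h := logIncrement_sub_comm (γ a b).continuous_extend (γ c d).continuous_extend
      (Hx a b c d hab hcd hac had hbc hbd)
    simp only [Path.extend_zero, Path.extend_one] at h
    rw [hn a b d hab had.symm hbd.symm, hn a b c hab hac.symm hbc.symm,
      hn c d b hcd hbc hbd, hn c d a hcd hac had] at h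
    have h1 := hm b d hbd
    have h2 := hm a d had
    have h3 := hm b c hbc
    have h4 := hm a c hac
    have : (((2 * m b d + 1) - (2 * m a d + 1) - (2 * m b c + 1) + (2 * m a c + 1) +
        2 * (n a b d - n a b c - n c d b + n c d a) : ℤ) : ℂ) = 0 := by
      apply mul_right_cancel₀ hπ
      push_cast at h1 h2 h3 h4 ⊢
      linear_combination h - h1 + h2 + h3 - h4
    exact_mod_cast this
  have e1 := hrel 0 1 2 3 (by decide) (by decide) (by decide) (by decide) (by decide) (by decide)
  have e2 := hrel 0 2 1 3 (by decide) (by decide) (by decide) (by decide) (by decide) (by decide)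
  have e3 := hrel 0 3 1 2 (by decide) (by decide) (by decide) (by decide) (by decide) (by decide)
  have e4 := hrel 0 1 2 4 (by decide) (by decide) (by decide) (by decide) (by decide) (by decide)
  have e5 := hrel 0 2 1 4 (by decide) (by decide) (by decide) (by decide) (by decide) (by decide)
  have e6 := hrel 0 4 1 2 (by decide) (by decide) (by decide) (by decide) (by decide) (by decide)
  have e7 := hrel 0 1 3 4 (by decide) (by decide) (by decide) (by decide) (by decide) (by decide)
  have e8 := hrel 0 3 1 4 (by decide) (by decide) (by decide) (by decide) (by decide) (by decide)
  have e9 := hrel 0 4 1 3 (by decide) (by decide) (by decide) (by decide) (by decide) (by decide)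
  have e10 := hrel 0 2 3 4 (by decide) (by decide) (by decide) (by decide) (by decide) (by decide)
  have e11 := hrel 0 3 2 4 (by decide) (by decide) (by decide) (by decide) (by decide) (by decide)
  have e12 := hrel 0 4 2 3 (by decide) (by decide) (by decide) (by decide) (by decide) (by decide)
  have e13 := hrel 1 2 3 4 (by decide) (by decide) (by decide) (by decide) (by decide) (by decide)
  have e14 := hrel 1 3 2 4 (by decide) (by decide) (by decide) (by decide) (by decide) (by decide)
  have e15 := hrel 1 4 2 3 (by decide) (by decide) (by decide) (by decide) (by decide) (by decide)
  have a1 := hanti 2 1 (by decide)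
  have a2 := hanti 3 1 (by decide)
  have a3 := hanti 3 2 (by decide)
  have a4 := hanti 4 1 (by decide)
  have a5 := hanti 4 2 (by decide)
  have a6 := hanti 4 3 (by decide)
  -- The sum of the fifteen relations is contradictory modulo 4. Each `n i j z` occurs twice with
  -- coefficient ±2 and cancels. The rest is a signed sum of odd numbers in which each unordered
  -- pair of vertices occurs six times; reduced by `hanti`, it is 2 modulo 4, since exactly five
  -- pairs of independent edges have interleaved ends.
  omega

/-! ### Plane drawings and the outer face -/

theorem isPathConnected_compl_closedBall_zero {E : Type*} [NormedAddCommGroup E] [NormedSpace ℝ E]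
    (h : 1 < Module.rank ℝ E) {R : ℝ} (hR : 0 ≤ R) :
    IsPathConnected (Metric.closedBall (0 : E) R)ᶜ := by
  have hc : IsPathConnected ({0}ᶜ : Set E) := isPathConnected_compl_singleton_of_one_lt_rank h 0
  -- This radial map adds `R` to the norm.
  have hf : ContinuousOn (fun y : E => (1 + R * ‖y‖⁻¹) • y) {0}ᶜ := by
    have : ContinuousOn (fun y : E => ‖y‖⁻¹) {0}ᶜ :=
      continuous_norm.continuousOn.inv₀ fun y hy => by simpa using hy
    fun_prop
  convert hc.image' hf using 1
  ext x
  simp only [Set.mem_compl_iff, Metric.mem_closedBall, dist_zero_right, not_le, Set.mem_image,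
    Set.mem_singleton_iff]
  constructor
  · intro hx
    have hx0 : 0 < ‖x‖ := hR.trans_lt hx
    have hpos : 0 < 1 - R * ‖x‖⁻¹ := by
      rw [sub_pos, ← div_eq_mul_inv, div_lt_one hx0]; exact hx
    refine ⟨(1 - R * ‖x‖⁻¹) • x, ?_, ?_⟩
    · simp [hpos.ne', norm_pos_iff.1 hx0]
    · rw [norm_smul, Real.norm_of_nonneg hpos.le, smul_smul]
      have : (1 + R * ((1 - R * ‖x‖⁻¹) * ‖x‖)⁻¹) * (1 - R * ‖x‖⁻¹) = 1 := by
        have h1 : ‖x‖ - R ≠ 0 := (sub_pos.2 hx).ne'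
        have h2 : (1 - R * ‖x‖⁻¹) * ‖x‖ = ‖x‖ - R := by field_simp
        rw [h2]; field_simp; ring
      rw [this, one_smul]
  · rintro ⟨y, hy, rfl⟩
    have hy0 : 0 < ‖y‖ := norm_pos_iff.2 hy
    rw [norm_smul, Real.norm_of_nonneg (by positivity), add_mul, mul_assoc,
      inv_mul_cancel₀ hy0.ne']
    linarith

/-- If any two of five points in the plane are joined inside a given set, then the sets of two
disjoint pairs of points meet. -/
theorem exists_not_disjoint_of_joinedIn (P : Fin 5 → EuclideanSpace ℝ (Fin 2))
    (K : Fin 5 → Fin 5 → Set (EuclideanSpace ℝ (Fin 2)))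
    (h : ∀ i j, i < j → JoinedIn (K i j) (P i) (P j)) :
    ∃ i j k l : Fin 5, i < j ∧ k < l ∧ i < k ∧ j ≠ k ∧ j ≠ l ∧ ¬ Disjoint (K i j) (K k l) := by
  set e := Complex.orthonormalBasisOneI.repr.symm
  have hγ : ∀ i j, ∃ γ : Path (e (P i)) (e (P j)), i < j → ∀ t, ∃ x ∈ K i j, γ t = e x := by
    intro i j
    by_cases hij : i < j
    · obtain ⟨γ, hγ⟩ := h i j hij
      exact ⟨γ.map e.continuous, fun _ t => ⟨γ t, hγ t, rfl⟩⟩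
    · obtain ⟨γ⟩ := PathConnectedSpace.joined (e (P i)) (e (P j))
      exact ⟨γ, fun h => absurd h hij⟩
  choose γ hγ using hγ
  obtain ⟨i, j, k, l, hij, hkl, hik, hjk, hjl, s, t, hst⟩ :=
    exists_path_meet_of_fin_five (fun i => e (P i)) γ
  refine ⟨i, j, k, l, hij, hkl, hik, hjk, hjl, ?_⟩
  obtain ⟨x, hx, hxs⟩ := hγ i j hij s
  obtain ⟨y, hy, hyt⟩ := hγ k l hkl t
  rw [Set.not_disjoint_iff]
  refine ⟨x, hx, ?_⟩
  rwa [e.injective (hxs.symm.trans (hst.trans hyt))]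

namespace SimpleGraph

variable {V : Type*} {G : SimpleGraph V}

/-- The part of a drawing that belongs to the subgraph induced on a set of vertices. -/
def PlaneDrawing.trace (D : G.PlaneDrawing) (X : Set V) : Set (EuclideanSpace ℝ (Fin 2)) :=
  D.pos '' X ∪ ⋃ d ∈ {d : G.Dart | d.fst ∈ X ∧ d.snd ∈ X}, Set.range (D.arc d)

theorem PlaneDrawing.trace_subset_support (D : G.PlaneDrawing) (X : Set V) :
    D.trace X ⊆ D.support :=
  Set.union_subset_union (Set.image_subset_range _ _)
    (Set.iUnion_mono fun _ => Set.iUnion_subset fun _ => subset_rfl)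

theorem PlaneDrawing.isCompact_trace [Finite V] (D : G.PlaneDrawing) (X : Set V) :
    IsCompact (D.trace X) := by
  have : Finite G.Dart := Finite.of_injective _ Dart.toProd_injective
  exact (X.toFinite.image _).isCompact.union
    ((Set.toFinite _).isCompact_biUnion fun d _ => isCompact_range (D.arc d).continuous)

theorem PlaneDrawing.support_eq_trace_univ (D : G.PlaneDrawing) :
    D.support = D.trace Set.univ := by
  simp [PlaneDrawing.support, PlaneDrawing.trace]

theorem PlaneDrawing.isCompact_support [Finite V] (D : G.PlaneDrawing) : IsCompact D.support :=
  D.support_eq_trace_univ ▸ D.isCompact_trace _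

theorem PlaneDrawing.disjoint_trace (D : G.PlaneDrawing) {X Y : Set V} (h : Disjoint X Y) :
    Disjoint (D.trace X) (D.trace Y) := by
  rw [Set.disjoint_left] at h ⊢
  intro z hX hY
  simp only [PlaneDrawing.trace, Set.mem_union, Set.mem_image, Set.mem_ofPred_eq,
    Set.mem_iUnion] at hX hY
  rcases hX with ⟨x, hx, rfl⟩ | ⟨d, ⟨hd1, hd2⟩, hzd⟩
  · rcases hY with ⟨y, hy, hxy⟩ | ⟨e, ⟨he1, he2⟩, hze⟩
    · exact h hx (D.pos_injective hxy ▸ hy)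
    · rcases D.eq_endpoint_of_pos_mem_arc e x hze with rfl | rfl
      exacts [h hx he1, h hx he2]
  · rcases hY with ⟨y, hy, rfl⟩ | ⟨e, ⟨he1, he2⟩, hze⟩
    · rcases D.eq_endpoint_of_pos_mem_arc d y hzd with rfl | rfl
      exacts [h hd1 hy, h hd2 hy]
    · have hmem : ∀ (d : G.Dart) (v : V), v ∈ d.edge → v = d.fst ∨ v = d.snd := fun d v hv => by
        simpa [Dart.edge] using hv
      have hde : d.edge ≠ e.edge := by
        intro hde
        rcases hmem e d.fst (hde ▸ by simp [Dart.edge]) with h' | h'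
        · exact h hd1 (h' ▸ he1)
        · exact h hd1 (h' ▸ he2)
      obtain ⟨v, hvd, hve, -⟩ := D.arc_inter_arc d e hde z ⟨hzd, hze⟩
      rcases hmem d v hvd with rfl | rfl <;> rcases hmem e _ hve with h' | h'
      exacts [h hd1 (h' ▸ he1), h hd1 (h' ▸ he2), h hd2 (h' ▸ he1), h hd2 (h' ▸ he2)]

theorem PlaneDrawing.pos_mem_trace (D : G.PlaneDrawing) {X : Set V} {x : V} (hx : x ∈ X) :
    D.pos x ∈ D.trace X :=
  Or.inl ⟨x, hx, rfl⟩

theorem PlaneDrawing.joinedIn_trace (D : G.PlaneDrawing) {X : Set V} {x y : V} (hx : x ∈ X)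
    (h : (G.induce X).spanningCoe.Reachable x y) : JoinedIn (D.trace X) (D.pos x) (D.pos y) := by
  rw [reachable_iff_reflTransGen] at h
  induction h with
  | refl => exact JoinedIn.refl (D.pos_mem_trace hx)
  | tail _ hadj ih =>
    obtain ⟨-, a, b, hab, rfl, rfl⟩ := hadj
    refine ih.trans ⟨D.arc ⟨(a.1, b.1), hab⟩, fun t => Or.inr ?_⟩
    simp only [Set.mem_iUnion]
    exact ⟨⟨(a.1, b.1), hab⟩, ⟨a.2, b.2⟩, t, rfl⟩

/-- Take `w` outside a ball that contains the drawing; every unbounded component of the complement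
leaves that ball. The final step inside a small ball around `z` avoids any claim that `z` is
accessible from the face by an arc. -/
theorem PlaneDrawing.exists_joinedIn_of_mem_frontier [Finite V] (D : G.PlaneDrawing) :
    ∃ w, ∀ z ∈ frontier D.outerFace, ∀ ε > 0,
      JoinedIn (D.supportᶜ ∪ Metric.ball z ε) w z := by
  obtain ⟨R, hR0, hR⟩ := D.isCompact_support.isBounded.subset_closedBall_lt 0 0
  have hconn := isPathConnected_compl_closedBall_zero (E := EuclideanSpace ℝ (Fin 2))
    (by rw [← Module.finrank_eq_rank]; simp) hR0.le
  have hopen : IsOpen D.supportᶜ := D.isCompact_support.isClosed.isOpen_compl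
  obtain ⟨w, hw⟩ := hconn.nonempty
  refine ⟨w, fun z hz ε hε => ?_⟩
  obtain ⟨p, hp, hzp⟩ := Metric.mem_closure_iff.1 (frontier_subset_closure hz) ε hε
  obtain ⟨hps, hpb⟩ := hp
  obtain ⟨u, hu, huR⟩ : ∃ u ∈ connectedComponentIn D.supportᶜ p,
      u ∈ (Metric.closedBall (0 : EuclideanSpace ℝ (Fin 2)) R)ᶜ := by
    by_contra! hcon
    exact hpb (Metric.isBounded_closedBall.subset fun u hu => not_not.1 (hcon u hu))
  have h1 : JoinedIn D.supportᶜ w u :=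
    (hconn.joinedIn w hw u huR).mono (Set.compl_subset_compl.2 hR)
  have h2 : JoinedIn D.supportᶜ u p :=
    ((hopen.connectedComponentIn.isConnected_iff_isPathConnected.1
      (isConnected_connectedComponentIn_iff.2 hps)).joinedIn u hu p
      (mem_connectedComponentIn hps)).mono (connectedComponentIn_subset _ _)
  have h3 : JoinedIn (Metric.ball z ε) p z :=
    (Metric.isPathConnected_ball hε).joinedIn p (by rwa [Metric.mem_ball']) z
      (Metric.mem_ball_self hε)
  exact ((h1.trans h2).mono Set.subset_union_left).trans (h3.mono Set.subset_union_right)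

/-- Of three neighbours of a vertex `v` of an outerplanar graph, one separates the other two in the
graph without `v`. -/
theorem IsOuterplanar.not_reachable [Finite V] (hG : G.IsOuterplanar) {v p q r : V}
    (hp : G.Adj v p) (hq : G.Adj v q) (hr : G.Adj v r) (hpq : p ≠ q) (hpr : p ≠ r) (hqr : q ≠ r)
    (h1 : (G.induce {v, r}ᶜ).spanningCoe.Reachable p q)
    (h2 : (G.induce {v, q}ᶜ).spanningCoe.Reachable p r)
    (h3 : (G.induce {v, p}ᶜ).spanningCoe.Reachable q r) : False := by
  obtain ⟨D, hD⟩ := hG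
  obtain ⟨w, hw⟩ := D.exists_joinedIn_of_mem_frontier
  have hε : ∀ x : V, ∃ ε > 0, Disjoint (Metric.ball (D.pos x) ε) (D.trace {x}ᶜ) := by
    intro x
    have hx : D.pos x ∈ (D.trace {x}ᶜ)ᶜ := fun hx => Set.disjoint_left.1
      (D.disjoint_trace (disjoint_compl_right (a := {x}))) (D.pos_mem_trace rfl) hx
    obtain ⟨ε, hε, hb⟩ := Metric.isOpen_iff.1 (D.isCompact_trace {x}ᶜ).isClosed.isOpen_compl _ hx
    exact ⟨ε, hε, Set.disjoint_left.2 fun y hy => hb hy⟩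
  choose ε hε hdisj using hε
  -- The ball around `D.pos x` may only meet arcs that end at `x`, and their edges are not
  -- independent of the edge from `w` to `x`.
  have hapex : ∀ (x : V) (X : Set V), x ∉ X →
      Disjoint (D.supportᶜ ∪ Metric.ball (D.pos x) (ε x)) (D.trace X) := by
    intro x X hx
    refine Set.disjoint_union_left.2 ⟨?_, ?_⟩
    · exact disjoint_compl_left.mono_right (D.trace_subset_support X)
    · refine (hdisj x).mono_right ?_
      exact Set.union_subset_union (Set.image_mono fun y hy hyx => hx (hyx ▸ hy))
        (Set.biUnion_mono (fun d hd => ⟨fun h => hx (h ▸ hd.1), fun h => hx (h ▸ hd.2)⟩)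
          fun _ _ => subset_rfl)
  have hedge : ∀ x, G.Adj v x → JoinedIn (D.trace {v, x}) (D.pos v) (D.pos x) := fun x hx =>
    D.joinedIn_trace (by simp) (Adj.reachable (by simp [hx]))
  let W : V → Set (EuclideanSpace ℝ (Fin 2)) :=
    fun x => D.supportᶜ ∪ Metric.ball (D.pos x) (ε x)
  obtain ⟨i, j, k, l, hij, hkl, hik, hjk, hjl, hK⟩ := exists_not_disjoint_of_joinedIn
    ![w, D.pos v, D.pos p, D.pos q, D.pos r]
    ![![∅, W v, W p, W q, W r],
      ![∅, ∅, D.trace {v, p}, D.trace {v, q}, D.trace {v, r}],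
      ![∅, ∅, ∅, D.trace {v, r}ᶜ, D.trace {v, q}ᶜ],
      ![∅, ∅, ∅, ∅, D.trace {v, p}ᶜ],
      ![∅, ∅, ∅, ∅, ∅]]
    (by
      intro i j hij
      fin_cases i <;> fin_cases j <;> first | exact absurd hij (by decide) | skip
      exacts [hw _ (hD v) _ (hε v), hw _ (hD p) _ (hε p), hw _ (hD q) _ (hε q),
        hw _ (hD r) _ (hε r), hedge p hp, hedge q hq, hedge r hr,
        D.joinedIn_trace (by simp [hp.ne', hpr]) h1, D.joinedIn_trace (by simp [hp.ne', hpq]) h2,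
        D.joinedIn_trace (by simp [hq.ne', hpq.symm]) h3])
  apply hK
  have hvp := hp.ne
  have hvq := hq.ne
  have hvr := hr.ne
  have hc : ∀ X : Set V, Disjoint (D.trace X) (D.trace Xᶜ) := fun X =>
    D.disjoint_trace disjoint_compl_right
  fin_cases i <;> fin_cases j <;> first | exact absurd hij (by decide) | skip
  all_goals fin_cases k <;> first | exact absurd hik (by decide) | exact absurd rfl hjk | skip
  all_goals fin_cases l <;> first | exact absurd hkl (by decide) | exact absurd rfl hjl | skip
  all_goals first
    | exact hc _
    | exact (hc _).symm
    | exact hapex _ _ (by simp [hvp, hvq, hvr, hvp.symm, hvq.symm, hvr.symm, hpq, hpr, hqr,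
        hpq.symm, hpr.symm, hqr.symm])

end SimpleGraph

/-! ### Rainbow colorings and gluing -/

theorem Finset.exists_injOn_eqOn_of_card_le {α β : Type*} [Fintype β] {s t : Finset α} (hst : s ⊆ t)
    (ht : t.card ≤ Fintype.card β) {f : α → β} (hf : Set.InjOn f s) :
    ∃ g : α → β, Set.InjOn g t ∧ Set.EqOn f g s := by
  classical
  have hcard : (t \ s).card ≤ ((s.image f)ᶜ).card := by
    rw [Finset.card_sdiff_of_subset hst, Finset.card_compl, Finset.card_image_of_injOn hf]
    omega
  obtain ⟨e⟩ : Nonempty ((t \ s : Finset α) ↪ ((s.image f)ᶜ : Finset β)) :=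
    Function.Embedding.nonempty_of_card_le (by rwa [Fintype.card_coe, Fintype.card_coe])
  have hout : ∀ x y (h : x ∈ t \ s), y ∈ s → (e ⟨x, h⟩ : β) ≠ f y := fun x y h hy heq =>
    (Finset.mem_compl.1 (e ⟨x, h⟩).2) (heq ▸ Finset.mem_image_of_mem f hy)
  refine ⟨fun x => if h : x ∈ t \ s then e ⟨x, h⟩ else f x, ?_, fun x hx => ?_⟩
  · intro x hx y hy hxy
    by_cases h : x ∈ t \ s <;> by_cases h' : y ∈ t \ s <;> simp only [h, h', dite_true,
      dite_false] at hxy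
    · simpa using e.injective (Subtype.ext hxy)
    · exact absurd hxy (hout x y h (by simpa [Finset.mem_coe.1 hy] using h'))
    · exact absurd hxy.symm (hout y x h' (by simpa [Finset.mem_coe.1 hx] using h))
    · exact hf (by simpa [Finset.mem_coe.1 hx] using h) (by simpa [Finset.mem_coe.1 hy] using h')
        hxy
  · simp [Finset.mem_coe.1 hx]

namespace SimpleGraph

variable {V : Type*} {G : SimpleGraph V}

/-- In the subgraph induced on `S`, any two vertices with a common neighbour in `A` have different
colors. -/
def IsRainbowOn (G : SimpleGraph V) {α : Type*} (A S : Set V) (c : V → α) : Prop :=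
  ∀ a ∈ A ∩ S, Set.InjOn c (G.neighborSet a ∩ S)

/-- Rainbow colorings of the two sides of a separation can be glued along a set `F` that contains
all the vertices outside `A`, and all the neighbours of the vertices in `A`, of the separator. -/
theorem IsRainbowOn.exists_union {α : Type*} [Fintype α] {A S₁ S₂ : Set V} {c₁ c₂ : V → α}
    (h₁ : G.IsRainbowOn A S₁ c₁) (h₂ : G.IsRainbowOn A S₂ c₂)
    (hA : ∀ x ∈ A, ∀ y ∈ A, ¬ G.Adj x y)
    (hsep : ∀ x ∈ S₁ \ S₂, ∀ y ∈ S₂ \ S₁, ¬ G.Adj x y) (F : Finset V)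
    (hF : F.card ≤ Fintype.card α) (hFB : (S₁ ∩ S₂) \ A ⊆ F)
    (hFA : ∀ a ∈ S₁ ∩ S₂ ∩ A, G.neighborSet a ∩ (S₁ ∪ S₂) ⊆ F)
    (hF₁ : Set.InjOn c₁ (F ∩ S₁)) (hF₂ : Set.InjOn c₂ (F ∩ S₂)) :
    ∃ c : V → α, G.IsRainbowOn A (S₁ ∪ S₂) c := by
  classical
  -- An injective coloring `g` of `F` extends `c₁`; permuting the colors of `c₂` by `σ` makes it
  -- agree with `g` as well.
  obtain ⟨g, hg, hg₁⟩ := Finset.exists_injOn_eqOn_of_card_le (f := c₁)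
    (Finset.filter_subset (· ∈ S₁) F) hF (by simpa [Set.inter_def] using hF₁)
  obtain ⟨σ, hσ⟩ := Equiv.Perm.exists_extending_pair
    (fun x : F.filter (· ∈ S₂) => c₂ x) (fun x : F.filter (· ∈ S₂) => g x)
    (fun x y hxy => Subtype.ext (hF₂ (Finset.mem_filter.1 x.2) (Finset.mem_filter.1 y.2) hxy))
    (fun x y hxy => Subtype.ext
      (hg (Finset.mem_filter.1 x.2).1 (Finset.mem_filter.1 y.2).1 hxy))
  have hσ' : ∀ x ∈ F, x ∈ S₂ → σ (c₂ x) = g x := fun x hx hx' =>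
    hσ ⟨x, Finset.mem_filter.2 ⟨hx, hx'⟩⟩
  have hg' : ∀ x ∈ F, x ∈ S₁ → c₁ x = g x := fun x hx hx' =>
    hg₁ (Finset.mem_coe.2 (Finset.mem_filter.2 ⟨hx, hx'⟩))
  set c : V → α := fun x => if x ∈ S₁ then c₁ x else σ (c₂ x)
  have hc₁ : ∀ x ∈ S₁, c x = c₁ x := fun x hx => if_pos hx
  have hc₂ : ∀ x ∈ S₂, x ∉ A → c x = σ (c₂ x) := by
    intro x hx hxA
    by_cases h : x ∈ S₁
    · have hxF : x ∈ F := hFB ⟨⟨h, hx⟩, hxA⟩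
      rw [hc₁ x h, hg' x hxF h, hσ' x hxF hx]
    · exact if_neg h
  have hcF : ∀ x ∈ F, x ∈ S₁ ∪ S₂ → c x = g x := by
    intro x hx hxS
    by_cases h : x ∈ S₁
    · rw [hc₁ x h, hg' x hx h]
    · rw [← hσ' x hx (hxS.resolve_left h)]
      exact if_neg h
  refine ⟨c, fun a ⟨haA, haS⟩ x hx y hy hxy => ?_⟩
  have hnA : ∀ z ∈ G.neighborSet a, z ∉ A := fun z hz hzA => hA a haA z hzA hz
  by_cases ha₁ : a ∈ S₁ <;> by_cases ha₂ : a ∈ S₂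
  · have hxF := hFA a ⟨⟨ha₁, ha₂⟩, haA⟩ hx
    have hyF := hFA a ⟨⟨ha₁, ha₂⟩, haA⟩ hy
    rw [hcF x hxF hx.2, hcF y hyF hy.2] at hxy
    exact hg hxF hyF hxy
  · have key : ∀ z ∈ G.neighborSet a ∩ (S₁ ∪ S₂), z ∈ S₁ := fun z hz => by
      by_contra h
      exact hsep a ⟨ha₁, ha₂⟩ z ⟨hz.2.resolve_left h, h⟩ hz.1
    rw [hc₁ x (key x hx), hc₁ y (key y hy)] at hxy
    exact h₁ a ⟨haA, ha₁⟩ ⟨hx.1, key x hx⟩ ⟨hy.1, key y hy⟩ hxy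
  · have key : ∀ z ∈ G.neighborSet a ∩ (S₁ ∪ S₂), z ∈ S₂ := fun z hz => by
      by_contra h
      exact hsep z ⟨hz.2.resolve_right h, h⟩ a ⟨ha₂, ha₁⟩ (G.adj_symm hz.1)
    rw [hc₂ x (key x hx) (hnA x hx.1), hc₂ y (key y hy) (hnA y hy.1)] at hxy
    exact h₂ a ⟨haA, ha₂⟩ ⟨hx.1, key x hx⟩ ⟨hy.1, key y hy⟩ (σ.injective hxy)
  · exact absurd haS (by simp [ha₁, ha₂])

/-- Rainbow colorings of proper subsets of `S` yield one of `S` if the two ends of an edge separate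
two vertices of `S`. -/
theorem exists_isRainbowOn_of_not_reachable [Fintype V] [DecidableRel G.Adj] {k : ℕ}
    (hdeg : G.maxDegree ≤ k) {A S : Set V} (hA : ∀ x ∈ A, ∀ y ∈ A, ¬ G.Adj x y)
    (hB : ∀ x ∉ A, ∀ y ∉ A, ¬ G.Adj x y)
    (ih : ∀ S' ⊂ S, ∃ c : V → Fin k, G.IsRainbowOn A S' c) {v q p r : V} (hvq : G.Adj v q)
    (hv : v ∈ S) (hq : q ∈ S) (hp : p ∈ S) (hr : r ∈ S) (hpv : p ≠ v) (hpq : p ≠ q) (hrv : r ≠ v)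
    (hrq : r ≠ q) (h : ¬ (G.induce {v, q}ᶜ).spanningCoe.Reachable p r) :
    ∃ c : V → Fin k, G.IsRainbowOn A S c := by
  classical
  wlog hvA : v ∈ A generalizing v q
  · have hqA : q ∈ A := by
      by_contra hqA
      exact hB v hvA q hqA hvq
    exact this hvq.symm hq hv hpq hpv hrq hrv (by rwa [Set.pair_comm]) hqA
  set C : Set V := {z | (G.induce {v, q}ᶜ).spanningCoe.Reachable p z} with hC
  -- In the spanning graph, `v` and `q` are isolated, so they are not reachable from `p`.
  have hiso : ∀ z ∈ C, z ≠ v ∧ z ≠ q := by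
    intro z hz
    rw [hC, Set.mem_ofPred_eq, reachable_iff_reflTransGen] at hz
    rcases Relation.ReflTransGen.cases_tail hz with rfl | ⟨y, -, hyz⟩
    · exact ⟨hpv, hpq⟩
    · have : z ∈ ({v, q}ᶜ : Set V) := by
        obtain ⟨-, a, b, -, -, rfl⟩ := hyz
        exact b.2
      simpa using this
  have hvC : v ∉ C := fun h => (hiso v h).1 rfl
  have hqC : q ∉ C := fun h => (hiso q h).2 rfl
  have hpC : p ∈ C := Reachable.refl p
  have hqA : q ∉ A := fun hqA => hA v hvA q hqA hvq
  obtain ⟨c₁, h₁⟩ := ih (S ∩ (C ∪ {v, q})) ⟨Set.inter_subset_left, fun hS => by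
    rcases (hS hr).2 with h' | h' | h'
    exacts [h h', hrv h', hrq h']⟩
  obtain ⟨c₂, h₂⟩ := ih (S \ C) ⟨Set.sdiff_subset, fun hS => (hS hp).2 hpC⟩
  have hunion : S ∩ (C ∪ {v, q}) ∪ S \ C = S := by
    ext z; by_cases hz : z ∈ C <;> simp +contextual [hz]
  have hinter : ∀ z ∈ S ∩ (C ∪ {v, q}) ∩ (S \ C), z = v ∨ z = q := by
    rintro z ⟨⟨-, h' | h'⟩, -, hz⟩
    exacts [absurd h' hz, h']
  -- The separator is `{v, q}`. The neighbours of `v` in `S` include `q`, number at most `k`, and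
  -- have distinct colors in each piece because both pieces contain `v`.
  have hc := h₁.exists_union h₂ hA ?_ (G.neighborFinset v ∩ S.toFinset) ?_ ?_ ?_ ?_ ?_
  · rwa [hunion] at hc
  · rintro x ⟨⟨hxS, hx⟩, hx'⟩ y ⟨⟨hyS, hyC⟩, hy⟩ hxy
    have hxC : x ∈ C := by by_contra hxC; exact hx' ⟨hxS, hxC⟩
    have hyn : y ∈ ({v, q}ᶜ : Set V) := fun hyn => hy ⟨hyS, Or.inr hyn⟩
    have hxn : x ∈ ({v, q}ᶜ : Set V) := by simpa using hiso x hxC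
    refine hyC (Reachable.trans hxC (Adj.reachable ?_))
    exact ⟨hxy.ne, ⟨x, hxn⟩, ⟨y, hyn⟩, hxy, rfl, rfl⟩
  · rw [Fintype.card_fin]
    exact ((Finset.card_le_card Finset.inter_subset_left).trans (G.degree_le_maxDegree v)).trans
      hdeg
  · rintro z ⟨hz, hzA⟩
    rcases hinter z hz with rfl | rfl
    · exact absurd hvA hzA
    · simpa using ⟨hvq, hq⟩
  · rintro a ⟨ha, haA⟩ z ⟨hz, hzS⟩
    rw [hunion] at hzS
    rcases hinter a ha with rfl | rfl
    · simpa using ⟨hz, hzS⟩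
    · exact absurd haA hqA
  · refine (h₁ v ⟨hvA, hv, Or.inr (by simp)⟩).mono fun z hz => ?_
    simp only [Finset.coe_inter, coe_neighborFinset, Set.coe_toFinset] at hz
    exact ⟨hz.1.1, hz.2⟩
  · refine (h₂ v ⟨hvA, hv, hvC⟩).mono fun z hz => ?_
    simp only [Finset.coe_inter, coe_neighborFinset, Set.coe_toFinset] at hz
    exact ⟨hz.1.1, hz.2⟩

/-- A rainbow coloring extends to a vertex `b` if no vertex has three neighbours in `S`. -/
theorem IsRainbowOn.exists_of_diff_singleton [Fintype V] [DecidableEq V] [DecidableRel G.Adj]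
    {k : ℕ} (hk : 3 ≤ k) {A : Set V} {S : Finset V} {b : V} {c : V → Fin k}
    (hc : G.IsRainbowOn A (S \ {b}) c) (hS : ∀ v ∈ S, (G.neighborFinset v ∩ S).card ≤ 2)
    (hb : b ∈ S) (hbA : b ∉ A) : ∃ c' : V → Fin k, G.IsRainbowOn A S c' := by
  classical
  -- `N` contains the vertices that share a neighbour in `S` with `b`: at most two neighbours, each
  -- with at most one further neighbour.
  set N : Finset V :=
    (G.neighborFinset b ∩ S).biUnion fun a => (G.neighborFinset a ∩ S).erase b with hN
  have hNcard : N.card ≤ 2 := by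
    refine (Finset.card_biUnion_le_card_mul _ _ 1 fun a ha => ?_).trans ?_
    · rw [Finset.mem_inter, mem_neighborFinset] at ha
      rw [Finset.card_erase_of_mem (by simpa using ⟨ha.1.symm, hb⟩)]
      have := hS a ha.2
      omega
    · simpa using hS b hb
  obtain ⟨i, hi⟩ : ∃ i, i ∉ N.image c := by
    by_contra! hall
    have := Finset.card_le_card (fun i _ => hall i : Finset.univ ⊆ N.image c)
    have := Finset.card_image_le (s := N) (f := c)
    simp only [Finset.card_univ, Fintype.card_fin] at *
    omega
  have hNi : ∀ a ∈ S, G.Adj a b → ∀ y ∈ S, G.Adj a y → y ≠ b → c y ≠ i := by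
    rintro a ha hab y hy hay hyb rfl
    refine hi (Finset.mem_image_of_mem c ?_)
    simp only [hN, Finset.mem_biUnion, Finset.mem_inter, mem_neighborFinset, Finset.mem_erase]
    exact ⟨a, ⟨hab.symm, ha⟩, hyb, hay, hy⟩
  refine ⟨Function.update c b i, fun a ⟨haA, haS⟩ x hx y hy hxy => ?_⟩
  by_cases hxb : x = b <;> by_cases hyb : y = b
  · rw [hxb, hyb]
  · subst hxb
    rw [Function.update_self, Function.update_of_ne hyb] at hxy
    exact absurd hxy.symm (hNi a haS hx.1 y hy.2 hy.1 hyb)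
  · subst hyb
    rw [Function.update_self, Function.update_of_ne hxb] at hxy
    exact absurd hxy (hNi a haS hy.1 x hx.2 hx.1 hxb)
  · rw [Function.update_of_ne hxb, Function.update_of_ne hyb] at hxy
    exact hc a ⟨haA, haS, fun h => hbA (h ▸ haA)⟩ ⟨hx.1, hx.2, hxb⟩ ⟨hy.1, hy.2, hyb⟩ hxy

theorem IsOuterplanar.exists_isRainbowOn [Fintype V] [DecidableRel G.Adj]
    (hG : G.IsOuterplanar) {k : ℕ} (hk : 3 ≤ k) (hdeg : G.maxDegree ≤ k) {A : Set V}
    (hA : ∀ x ∈ A, ∀ y ∈ A, ¬ G.Adj x y) (hB : ∀ x ∉ A, ∀ y ∉ A, ¬ G.Adj x y) (S : Finset V) :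
    ∃ c : V → Fin k, G.IsRainbowOn A S c := by
  classical
  induction S using Finset.strongInduction with
  | H S ih =>
    have ih' : ∀ S' ⊂ (S : Set V), ∃ c : V → Fin k, G.IsRainbowOn A S' c := by
      intro S' hS'
      have := ih S'.toFinset (by rw [← Finset.coe_ssubset]; simpa using hS')
      simpa using this
    by_cases hS : ∀ v ∈ S, (G.neighborFinset v ∩ S).card ≤ 2
    · by_cases hSA : ∃ b ∈ S, b ∉ A
      · obtain ⟨b, hb, hbA⟩ := hSA
        obtain ⟨c, hc⟩ := ih' (S \ {b}) ⟨Set.sdiff_subset, fun h => (h hb).2 rfl⟩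
        exact hc.exists_of_diff_singleton hk hS hb hbA
      · push Not at hSA
        exact ⟨fun _ => ⟨0, by omega⟩, fun a ha x hx => absurd hx.1 (hA a ha.1 x (hSA x hx.2))⟩
    · push Not at hS
      obtain ⟨v, hv, hcard⟩ := hS
      obtain ⟨p, hp, q, hq, r, hr, hpq, hpr, hqr⟩ := Finset.two_lt_card.1 hcard
      simp only [Finset.mem_inter, mem_neighborFinset] at hp hq hr
      have sep := @exists_isRainbowOn_of_not_reachable V G _ _ k hdeg A S hA hB ih' v
      by_cases h1 : (G.induce {v, r}ᶜ).spanningCoe.Reachable p q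
      · by_cases h2 : (G.induce {v, q}ᶜ).spanningCoe.Reachable p r
        · exact sep hp.1 hv hp.2 hq.2 hr.2 hq.1.ne' hpq.symm hr.1.ne' hpr.symm
            fun h3 => hG.not_reachable hp.1 hq.1 hr.1 hpq hpr hqr h1 h2 h3
        · exact sep hq.1 hv hq.2 hp.2 hr.2 hp.1.ne' hpq hr.1.ne' hqr.symm h2
      · exact sep hr.1 hv hr.2 hp.2 hq.2 hp.1.ne' hpr hq.1.ne' hqr h1

/-! ### From rainbow colorings to packing colorings -/

/-- In a bipartite graph, a class of a coloring of one side that separates any two vertices with a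
common neighbour is a `3`-packing. -/
theorem IsRainbowOn.isDistPacking {α : Type*} {A : Set V} {c : V → α}
    (hc : G.IsRainbowOn A Set.univ c) (hA : ∀ x ∈ A, ∀ y ∈ A, ¬ G.Adj x y)
    (hB : ∀ x ∉ A, ∀ y ∉ A, ¬ G.Adj x y) (i : α) : G.IsDistPacking 3 (c ⁻¹' {i} \ A) := by
  rintro x ⟨hxi, hxA⟩ y ⟨hyi, hyA⟩ hxy
  by_contra! hd
  have hadj : ∀ {a b}, G.Adj a b → (a ∈ A ↔ b ∉ A) := fun {a b} hab =>
    ⟨fun ha hb => hA a ha b hb hab, fun hb => by_contra fun ha => hB a ha b hb hab⟩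
  obtain ⟨w, hw⟩ := exists_walk_of_edist_ne_top (ne_top_of_le_ne_top (ENat.natCast_ne_top 3) hd)
  rw [← hw, Nat.cast_le] at hd
  -- Lengths 1 and 3 contradict the bipartition; length 2 gives a common neighbour in `A`.
  match w, hd with
  | .nil, _ => exact hxy rfl
  | .cons h .nil, _ => exact hB _ hxA _ hyA h
  | .cons h (.cons h' .nil), _ =>
    refine hxy (hc _ ⟨?_, trivial⟩ ⟨h.symm, trivial⟩ ⟨h', trivial⟩ (hxi.trans hyi.symm))
    exact (hadj h').2 hyA
  | .cons h (.cons h' (.cons h'' .nil)), _ =>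
    exact hxA ((hadj h).2 fun h2 => (hadj h').1 h2 ((hadj h'').2 hyA))
  | .cons _ (.cons _ (.cons _ (.cons _ _))), hd => simp at hd; omega

end SimpleGraph

theorem theorem2 {V : Type*} [Fintype V] (G : SimpleGraph V) [DecidableRel G.Adj] (k : ℕ)
    (hk : 3 ≤ k) (hbip : G.IsBipartite) (hout : G.IsOuterplanar) (hdeg : G.maxDegree ≤ k) :
    G.IsPackingColorable (Fin.cons 1 (fun _ => 3) : Fin (k + 1) → ℕ) := by
  classical
  obtain ⟨C⟩ := hbip
  set A : Set V := {x | C x = 0} with hAdef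
  have hA : ∀ x ∈ A, ∀ y ∈ A, ¬ G.Adj x y := fun x hx y hy h => C.valid h (hx.trans hy.symm)
  have hB : ∀ x ∉ A, ∀ y ∉ A, ¬ G.Adj x y := fun x hx y hy h =>
    C.valid h ((Fin.eq_one_of_ne_zero _ hx).trans (Fin.eq_one_of_ne_zero _ hy).symm)
  obtain ⟨c, hc⟩ := hout.exists_isRainbowOn hk hdeg hA hB Finset.univ
  rw [Finset.coe_univ] at hc
  refine ⟨fun x => if x ∈ A then 0 else (c x).succ, fun i => ?_⟩
  have hmem : ∀ x, x ∉ A → ∀ j : Fin k, (if x ∈ A then 0 else (c x).succ) = j.succ → c x = j :=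
    fun x hx j h => Fin.succ_injective _ (by simpa [hx] using h)
  refine Fin.cases ?_ (fun j => ?_) i
  · intro x hx y hy hxy
    have h0 : ∀ z, (if z ∈ A then 0 else (c z).succ) = (0 : Fin (k + 1)) → z ∈ A := fun z hz => by
      by_contra hzA
      simp [hzA] at hz
    rw [Fin.cons_zero, Nat.cast_one]
    by_contra! hd
    rcases SimpleGraph.edist_le_one_iff_adj_or_eq.1 hd with h | h
    · exact hA x (h0 x hx) y (h0 y hy) h
    · exact hxy h
  · have h0 : ∀ z, (if z ∈ A then 0 else (c z).succ) = j.succ → z ∉ A := fun z hz hzA => by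
      simp [hzA] at hz
      exact Fin.succ_ne_zero _ hz.symm
    intro x hx y hy hxy
    rw [Fin.cons_succ]
    exact hc.isDistPacking hA hB j x ⟨hmem x (h0 x hx) j hx, h0 x hx⟩ y
      ⟨hmem y (h0 y hy) j hy, h0 y hy⟩ hxy
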